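/- **Conventions.** A *normal o-graph* is an oriented virtual link diagram, considered up to planar isotopy and the virtual Reidemeister-type moves, so that only the signed real crossings and the way they are connected along the strands matter (every component has a real crossing); *open* normal o-graphs (tangle diagrams) may also have open ends at which strands enter or leave. A *local move* replaces a given open normal o-graph $L$ inside a larger diagram by another one $R$ with the same ends. A crossing represents a branched tetrahedron with vertices $0<1<2<3$: the four edges at the crossing are dual to its faces (face $f$ is opposite to the vertex $f$), the over strand joins the faces $0,1$, the under strand joins the faces $2,3$; at a positive crossing the strands come in through the faces $0,2$ and go out through the faces $1,3$, at a negative crossing conversely. *MP moves.* The 16 (Matveev--Piergallini) MP moves are the local moves dual to those branched Pachner $2$-$3$ moves that preserve the associated vector field: for $i<j$ in $\{0,\dots,4\}$ with $\{i,j\}\ne\{0,1\},\{3,4\}$ and for each of the two orientations, the two tetrahedra opposite to the vertices $i,j$ in the boundary of the ordered $4$-simplex $0<1<2<3<4$ are replaced by the three other tetrahedra. The *primary MP move* is the move on three parallel strands $1,2,3$ with only positive crossings, in which the strand with the smaller number is always the over strand: the diagram with a crossing of the strands $2,3$ followed by a crossing of $1,2$ is replaced by the diagram with crossings of $1,2$,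 then $1,3$, then $2,3$. *Pure sliding moves.* In the circuit diagram of a normal o-graph each edge carries three lines, numbered from left to right; for the edge dual to a triangle $a<b<c$ they correspond to $ab$, $bc$, $ac$ in this order, and two lines are joined at a crossing if they correspond to the same edge of the dual tetrahedron there. A pure sliding move lets one of two distinct edges (left, right) run over the other one in two new crossings of opposite signs. There are four types, each of which may be performed only if two lines lie on the same circuit: * ps-I: third line on the left and second line on the right; parallel edges, left edge over, first crossing positive; * ps-II: third line on the left and first line on the right; parallel edges, right edge over, first crossing negative; * ps-III: first line on the left and second line on the right; antiparallel edges, left edge over, the over strand meets the positive crossing first; * ps-IV: third line on the left and third line on the right; antiparallel edges, the over strand meets the negative crossing first. A *local pure sliding move* is a pure sliding move performed on the two-crossing side $L$ of an MP move $M$, as a local move, such that its condition already holds in the circuit diagram of the open diagram $L$, and such that $M=N^{-1}\circ(\text{this pure sliding move})$ for some MP move $N$. **Proposition.** There is a set $S$ of exactly 18 local pure sliding moves with the following property. For every MP move $M$ there is a subset $A\subseteq S$ of 15 moves such that every MP move is a sequence of moves each of which is $M$, a move from $A$, or the inverse of one of these: whenever a normal o-graph $\Gamma'$ (possibly with open ends)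 is obtained from $\Gamma$ by an MP move, $\Gamma$ and $\Gamma'$ are related by such a sequence. Moreover, there is also a subset $A\subseteq S$ of 15 moves such that every MP move is a sequence of moves each of which is the primary MP move, a move from $A$, or the inverse of one of these. -/

import Mathlib

/-- The two strands that meet at a real crossing. -/
inductive Strand
  | over
  | under
  deriving DecidableEq

instance : Fintype Strand :=
  ⟨{Strand.over, Strand.under}, fun s => by cases s <;> decide⟩

/-- A normal o-graph with open ends: an oriented virtual link (tangle) diagram up to planar isotopy
and the Reidemeister type moves, which forget everything but the signed real crossings and the way
they are joined.
`I` is the set of open ends at which the diagram is entered, `O` the set of open ends at which it is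
left; a (closed) normal o-graph is the case `I = O = ∅`.
Every crossing has one outgoing and one incoming half-edge on each of its two strands. An edge
leaves a crossing along a strand, or starts at an end in `I`; `next` says where it arrives: at a
crossing along a strand, or at an end in `O`. There are no components without crossings, since the
singular set of a standard polyhedron has none. -/
structure OGraph (I O : Type) where
  /-- the real crossings (true vertices) -/
  V : Type
  fin : Finite V
  /-- `true` for a positive crossing, `false` for a negative one -/
  pos : V → Bool
  /-- the edges, from their start to their end -/
  next : (V × Strand) ⊕ I ≃ (V × Strand) ⊕ O

namespace OGraph

variable {I O : Type}

/-- The edges of a normal o-graph, named by their starts. -/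
abbrev Edge (Γ : OGraph I O) : Type := (Γ.V × Strand) ⊕ I

/-! ### The circuit diagram (Method B)

A crossing is dual to a branched tetrahedron with vertices `0 < 1 < 2 < 3`, and the four edges at it
are dual to the faces of the tetrahedron; face `f` is the one opposite to the vertex `f`. The over
strand joins the faces `0` and `1`, the under strand joins the faces `2` and `3`. At a positive
crossing the strands come in through the faces `0`, `2` and go out through the faces `1`, `3`; at a
negative crossing it is the other way round.

An edge of the o-graph, dual to a triangle `a < b < c`, carries three lines, counted from left to
right: the first one is dual to `ab`, the second one to `bc`, and the third one (the local `2`-cell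
that starts the branching) to `ac`. -/

/-- The strand of a crossing that passes through the face `f` of the dual tetrahedron. -/
def faceStrand (f : Fin 4) : Strand := if f.val < 2 then Strand.over else Strand.under

/-- The edge of `Γ` that is dual to the face `f` of the tetrahedron dual to the crossing `v`. -/
def faceEdge (Γ : OGraph I O) (v : Γ.V) (f : Fin 4) : Γ.Edge :=
  if (f.val % 2 == 0) = Γ.pos v then Γ.next.symm (Sum.inl (v, faceStrand f))
  else Sum.inl (v, faceStrand f)

/-- The edge of the tetrahedron that is dual to line number `k` (counted from `0`) on the edge of the
o-graph that is dual to the face `f`. -/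
def lineDual (f : Fin 4) (k : Fin 3) : Fin 4 × Fin 4 :=
  match k with
  | 0 => (f.succAbove 0, f.succAbove 1)
  | 1 => (f.succAbove 1, f.succAbove 2)
  | 2 => (f.succAbove 0, f.succAbove 2)

/-- The circuit diagram joins two lines at a crossing when they bound the same local `2`-cell there,
that is, when they are dual to the same edge of the dual tetrahedron. -/
def LineJoined (Γ : OGraph I O) (x y : Γ.Edge × Fin 3) : Prop :=
  ∃ (v : Γ.V) (f g : Fin 4), Γ.faceEdge v f = x.1 ∧ Γ.faceEdge v g = y.1 ∧
    lineDual f x.2 = lineDual g y.2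

/-- Two lines lie on the same circuit of the circuit diagram. -/
def LineConnected (Γ : OGraph I O) : Γ.Edge × Fin 3 → Γ.Edge × Fin 3 → Prop :=
  Relation.EqvGen Γ.LineJoined

/-! ### Inserting a local move into a context -/

/-- `Γ` is the result of putting the diagram `T` into the hole of the context `C`.
The context has, besides the ends `I`, `O` of `Γ`, the ends `Q` at which `T` is left (and `C` is
entered) and the ends `J` at which `T` is entered (and `C` is left). The crossings of `Γ` are those
of `C` and of `T`, with their signs; the edges of `T` between crossings are edges of `Γ`; and every
edge `a → b` of `C` becomes an edge of `Γ`, prolonged at its start by the edge of `T` that ends at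
`a` if `a` is in `Q`, and at its end by the edge of `T` that starts at `b` if `b` is in `J`.
This is used only for `T` in which each edge has a crossing at one of its ends at least. -/
def IsGlued {J Q : Type} (C : OGraph (Q ⊕ I) (J ⊕ O)) (T : OGraph J Q) (Γ : OGraph I O) : Prop :=
  ∃ ι : C.V ⊕ T.V ≃ Γ.V,
    (∀ v, Γ.pos (ι (Sum.inl v)) = C.pos v) ∧
    (∀ v, Γ.pos (ι (Sum.inr v)) = T.pos v) ∧
    (∀ v s w t, T.next (Sum.inl (v, s)) = Sum.inl (w, t) →
      Γ.next (Sum.inl (ι (Sum.inr v), s)) = Sum.inl (ι (Sum.inr w), t)) ∧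
    (∀ (a : (C.V × Strand) ⊕ (Q ⊕ I)) (x : (Γ.V × Strand) ⊕ I) (y : (Γ.V × Strand) ⊕ O),
      (match a with
        | Sum.inl (v, s) => x = Sum.inl (ι (Sum.inl v), s)
        | Sum.inr (Sum.inl q) =>
            ∃ v s, T.next (Sum.inl (v, s)) = Sum.inr q ∧ x = Sum.inl (ι (Sum.inr v), s)
        | Sum.inr (Sum.inr i) => x = Sum.inr i) →
      (match C.next a with
        | Sum.inl (v, s) => y = Sum.inl (ι (Sum.inl v), s)
        | Sum.inr (Sum.inl j) =>
            ∃ v s, T.next (Sum.inr j) = Sum.inl (v, s) ∧ y = Sum.inl (ι (Sum.inr v), s)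
        | Sum.inr (Sum.inr o) => y = Sum.inr o) →
      Γ.next x = y)

/-- The local move that replaces `L` by `R`, performed somewhere in `Γ`, gives `Γ'`. -/
def LocalMove {J Q : Type} (L R : OGraph J Q) (Γ Γ' : OGraph I O) : Prop :=
  ∃ C : OGraph (Q ⊕ I) (J ⊕ O), IsGlued C L Γ ∧ IsGlued C R Γ'

end OGraph

/-! ### Pure sliding moves -/

/-- The four types ps-I, ps-II, ps-III, ps-IV of pure sliding moves. -/
inductive PSKind
  | I
  | II
  | III
  | IV
  deriving DecidableEq

namespace PSKind

/-- The line on the left edge in the conditions (PS-I) -- (PS-IV), counted from `0`. -/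
def leftLine : PSKind → Fin 3
  | I => 2
  | II => 2
  | III => 0
  | IV => 2

/-- The line on the right edge in the conditions (PS-I) -- (PS-IV), counted from `0`. -/
def rightLine : PSKind → Fin 3
  | I => 1
  | II => 0
  | III => 1
  | IV => 2

/-- Whether the left edge is the over strand of the two new crossings. (In type IV the picture with
the right edge over is the same one, turned by `π`.) -/
def leftOver : PSKind → Bool
  | I => true
  | II => false
  | III => true
  | IV => true

/-- The sign of the new crossing that the over strand meets first. -/
def overFirst : PSKind → Bool
  | I => true
  | II => false
  | III => true
  | IV => false

/-- The sign of the new crossing that the under strand meets first. It is the same crossing when the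
two edges are parallel (I, II), and the other one when they are antiparallel (III, IV). -/
def underFirst : PSKind → Bool
  | I => true
  | II => false
  | III => false
  | IV => true

end PSKind

namespace OGraph

variable {I O : Type}

/-- The disjoint union of `Γ` and two crossings, `true` (positive) and `false` (negative), whose over
strands form a circle, and whose under strands form a circle. -/
def addPair (Γ : OGraph I O) :
    ((Γ.V ⊕ Bool) × Strand) ⊕ I ≃ ((Γ.V ⊕ Bool) × Strand) ⊕ O where
  toFun
    | Sum.inl (Sum.inl v, s) => (Γ.next (Sum.inl (v, s))).map (Prod.map Sum.inl id) id
    | Sum.inl (Sum.inr c, s) => Sum.inl (Sum.inr (!c), s)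
    | Sum.inr i => (Γ.next (Sum.inr i)).map (Prod.map Sum.inl id) id
  invFun
    | Sum.inl (Sum.inl v, s) => (Γ.next.symm (Sum.inl (v, s))).map (Prod.map Sum.inl id) id
    | Sum.inl (Sum.inr c, s) => Sum.inl (Sum.inr (!c), s)
    | Sum.inr o => (Γ.next.symm (Sum.inr o)).map (Prod.map Sum.inl id) id
  left_inv := by
    rintro (⟨v | c, s⟩ | i)
    · rcases h : Γ.next (Sum.inl (v, s)) with ⟨w, t⟩ | o <;>
        simp [h, (Equiv.symm_apply_eq _).2 h.symm]
    · simp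
    · rcases h : Γ.next (Sum.inr i) with ⟨w, t⟩ | o <;>
        simp [h, (Equiv.symm_apply_eq _).2 h.symm]
  right_inv := by
    rintro (⟨v | c, s⟩ | o)
    · rcases h : Γ.next.symm (Sum.inl (v, s)) with ⟨w, t⟩ | i <;>
        simp [h, ← (Equiv.symm_apply_eq _).1 h]
    · simp
    · rcases h : Γ.next.symm (Sum.inr o) with ⟨w, t⟩ | i <;>
        simp [h, ← (Equiv.symm_apply_eq _).1 h]

/-- An edge of `Γ`, as an edge (start) in a diagram with two more crossings. -/
def oldEdge (Γ : OGraph I O) : Γ.Edge → ((Γ.V ⊕ Bool) × Strand) ⊕ I :=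
  Sum.map (Prod.map Sum.inl id) id

open Classical in
/-- Let the edge `a` of `Γ` run over the edge `b` twice, in two new crossings of opposite signs: `a`
is cut and runs first through the crossing `c`, then through `!c`, as the over strand, and `b` is cut
and runs first through the crossing `d`, then through `!d`, as the under strand. (Exchanging the
successors of two edges merges a circle into an edge.) -/
noncomputable def insertPair (Γ : OGraph I O) (a b : Γ.Edge) (c d : Bool) : OGraph I O where
  V := Γ.V ⊕ Bool
  fin := by
    have := Γ.fin
    infer_instance
  pos := Sum.elim Γ.pos id
  next := ((Equiv.swap (Γ.oldEdge a) (Sum.inl (Sum.inr (!c), Strand.over))).trans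
    (Equiv.swap (Γ.oldEdge b) (Sum.inl (Sum.inr (!d), Strand.under)))).trans Γ.addPair

/-- The diagram after a pure sliding move of type `k` on the left edge `l` and the right edge `r`. -/
noncomputable def slide (Γ : OGraph I O) (k : PSKind) (l r : Γ.Edge) : OGraph I O :=
  if k.leftOver then Γ.insertPair l r k.overFirst k.underFirst
  else Γ.insertPair r l k.overFirst k.underFirst

/-- The pure sliding move of type `k` may be performed on the two edges `l` (left) and `r` (right):
the respective condition (PS-I) -- (PS-IV) holds in the circuit diagram of `Γ`. -/
def CanSlide (Γ : OGraph I O) (k : PSKind) (l r : Γ.Edge) : Prop :=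
  l ≠ r ∧ Γ.LineConnected (l, k.leftLine) (r, k.rightLine)

end OGraph

/-! ### The 16 MP moves

An MP move is dual to a branched Pachner `2`-`3` move, which exchanges two complementary parts of the
boundary of a `4`-simplex with totally ordered vertices `0 < 1 < 2 < 3 < 4`: the two tetrahedra
opposite to the vertices `i < j`, which share a triangle, and the three tetrahedra around the edge
`ij`. There are two orientations. If `{i, j}` is `{0, 1}` or `{3, 4}`, the move changes the vector
field ("bumping" moves); the other `8 · 2 = 16` moves are the MP moves. -/

namespace Simplex

/-- Whether the tetrahedron opposite to `k` is a positive crossing in the boundary of the ordered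
`4`-simplex with orientation `ε`. -/
def sgn (ε : Bool) (k : Fin 5) : Bool := (k.val % 2 == 0) == ε

/-- The face of the dual tetrahedron through which a strand leaves a crossing. -/
def outFace (positive : Bool) (s : Strand) : Fin 4 :=
  match positive, s with
  | true, Strand.over => 1
  | true, Strand.under => 3
  | false, Strand.over => 0
  | false, Strand.under => 2

/-- Where the edge arrives that leaves along a strand of the crossing opposite to the vertex `k`:
when it leaves through the face opposite to `l`, it arrives at the crossing opposite to `l`, through
the face opposite to `k`. -/
def step (ε : Bool) (h : Fin 5 × Strand) : Fin 5 × Strand :=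
  let l := h.1.succAbove (outFace (sgn ε h.1) h.2)
  (l, if h.1 < l then OGraph.faceStrand ⟨h.1.val % 4, Nat.mod_lt _ (by norm_num)⟩
      else OGraph.faceStrand ⟨(h.1.val - 1) % 4, Nat.mod_lt _ (by norm_num)⟩)

/-- The edges of the normal o-graph with five crossings that is dual to the boundary of the ordered
`4`-simplex. Changing the orientation reverses all of them. -/
def next (ε : Bool) : Equiv.Perm (Fin 5 × Strand) where
  toFun := step ε
  invFun := step (!ε)
  left_inv := by
    revert ε
    unfold Function.LeftInverse
    decide
  right_inv := by
    revert ε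
    unfold Function.RightInverse Function.LeftInverse
    decide

/-- The edges of a closed diagram that touch the set of crossings of colour `b`, from starts to ends.
An edge that arrives from the other colour starts at an open end, one that leaves for the other
colour ends at an open end; both are named by their start. -/
def cut {V : Type} (P : Equiv.Perm (V × Strand)) (K : V → Bool) (b : Bool) :
    ({v // K v = b} × Strand) ⊕ {h : V × Strand // K h.1 = (!b) ∧ K (P h).1 = b} ≃
    ({v // K v = b} × Strand) ⊕ {h : V × Strand // K h.1 = b ∧ K (P h).1 = (!b)} where
  toFun
    | Sum.inl (v, s) =>
        if hk : K (P (v.1, s)).1 = b then Sum.inl (⟨_, hk⟩, (P (v.1, s)).2)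
        else Sum.inr ⟨(v.1, s), v.2, Bool.eq_not.2 hk⟩
    | Sum.inr h => Sum.inl (⟨_, h.2.2⟩, (P h.1).2)
  invFun
    | Sum.inl (v, s) =>
        if hk : K (P.symm (v.1, s)).1 = b then Sum.inl (⟨_, hk⟩, (P.symm (v.1, s)).2)
        else Sum.inr ⟨P.symm (v.1, s), Bool.eq_not.2 hk, by simpa using v.2⟩
    | Sum.inr h => Sum.inl (⟨h.1.1, h.2.1⟩, h.1.2)
  left_inv := by
    rintro (⟨⟨v, hv⟩, s⟩ | ⟨⟨v, s⟩, h1, h2⟩)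
    · by_cases hk : K (P (v, s)).1 = b
      · simp [hk, hv]
      · simp [hk]
    · have hn : ¬ K v = b := Bool.eq_not.1 h1
      simp [hn]
  right_inv := by
    rintro (⟨⟨v, hv⟩, s⟩ | ⟨⟨v, s⟩, h1, h2⟩)
    · by_cases hk : K (P.symm (v, s)).1 = b
      · simp [hk, hv]
      · simp [hk]
    · have hn : ¬ K (P (v, s)).1 = b := Bool.eq_not.1 h2
      simp [hn]

end Simplex

/-- The 16 MP moves. -/
structure MPMove where
  /-- the smaller of the two vertices that are joined by a new edge -/
  i : Fin 5
  /-- the larger of the two vertices that are joined by a new edge -/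
  j : Fin 5
  /-- the orientation -/
  ε : Bool
  lt : i < j
  not_bump₀ : ¬ (i = 0 ∧ j = 1)
  not_bump₁ : ¬ (i = 3 ∧ j = 4)

namespace MPMove

/-- Whether the tetrahedron opposite to `k` is one of the two on the left side of the move. -/
def isLeft (m : MPMove) (k : Fin 5) : Bool := k == m.i || k == m.j

/-- The ends at which the left (and the right) side of the move is entered. They are named by the
edges of the closed diagram on the boundary of the `4`-simplex that run from the left part to the
right part; in the left side of the move, all orientations are opposite to those in this diagram. -/
abbrev In (m : MPMove) : Type :=
  {h : Fin 5 × Strand // m.isLeft h.1 = true ∧ m.isLeft (Simplex.next m.ε h).1 = false}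

/-- The ends at which the left (and the right) side of the move is left. -/
abbrev Out (m : MPMove) : Type :=
  {h : Fin 5 × Strand // m.isLeft h.1 = false ∧ m.isLeft (Simplex.next m.ε h).1 = true}

/-- The diagram with two crossings before the MP move. -/
def left (m : MPMove) : OGraph m.In m.Out where
  V := {k // m.isLeft k = true}
  fin := inferInstance
  pos k := !(Simplex.sgn m.ε k.1)
  next := (Simplex.cut (Simplex.next m.ε) m.isLeft true).symm

/-- The diagram with three crossings after the MP move. -/
def right (m : MPMove) : OGraph m.In m.Out where
  V := {k // m.isLeft k = false}
  fin := inferInstance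
  pos k := Simplex.sgn m.ε k.1
  next := Simplex.cut (Simplex.next m.ε) m.isLeft false

/-- `Γ'` is obtained from `Γ` by the MP move `m`. -/
def Move (m : MPMove) {I O : Type} (Γ Γ' : OGraph I O) : Prop :=
  OGraph.LocalMove m.left m.right Γ Γ'

end MPMove

/-! ### The primary MP move

It relates two diagrams on three parallel strands `0`, `1`, `2`, all of whose crossings are positive:
`S₂₃ S₁₂ = S₁₂ S₁₃ S₂₃`. The strand with the smaller number is always the over strand. -/

namespace PrimaryMP

/-- On the left side, the crossing `0` is between the strands `1`, `2`, and the crossing `1`, which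
comes after it, is between the strands `0`, `1`. -/
def left : OGraph (Fin 3) (Fin 3) where
  V := Fin 2
  fin := inferInstance
  pos _ := true
  next :=
    { toFun := fun
        | Sum.inr 0 => Sum.inl (1, Strand.over)
        | Sum.inl (1, Strand.over) => Sum.inr 0
        | Sum.inr 1 => Sum.inl (0, Strand.over)
        | Sum.inl (0, Strand.over) => Sum.inl (1, Strand.under)
        | Sum.inl (1, Strand.under) => Sum.inr 1
        | Sum.inr 2 => Sum.inl (0, Strand.under)
        | Sum.inl (0, Strand.under) => Sum.inr 2
      invFun := fun
        | Sum.inr 0 => Sum.inl (1, Strand.over)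
        | Sum.inl (1, Strand.over) => Sum.inr 0
        | Sum.inr 1 => Sum.inl (1, Strand.under)
        | Sum.inl (1, Strand.under) => Sum.inl (0, Strand.over)
        | Sum.inl (0, Strand.over) => Sum.inr 1
        | Sum.inr 2 => Sum.inl (0, Strand.under)
        | Sum.inl (0, Strand.under) => Sum.inr 2
      left_inv := by unfold Function.LeftInverse; decide
      right_inv := by unfold Function.RightInverse Function.LeftInverse; decide }

/-- On the right side, the crossings `0`, `1`, `2` are, in this order, between the strands `0`, `1`,
between the strands `0`, `2`, and between the strands `1`, `2`. -/
def right : OGraph (Fin 3) (Fin 3) where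
  V := Fin 3
  fin := inferInstance
  pos _ := true
  next :=
    { toFun := fun
        | Sum.inr 0 => Sum.inl (0, Strand.over)
        | Sum.inl (0, Strand.over) => Sum.inl (1, Strand.over)
        | Sum.inl (1, Strand.over) => Sum.inr 0
        | Sum.inr 1 => Sum.inl (0, Strand.under)
        | Sum.inl (0, Strand.under) => Sum.inl (2, Strand.over)
        | Sum.inl (2, Strand.over) => Sum.inr 1
        | Sum.inr 2 => Sum.inl (1, Strand.under)
        | Sum.inl (1, Strand.under) => Sum.inl (2, Strand.under)
        | Sum.inl (2, Strand.under) => Sum.inr 2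
      invFun := fun
        | Sum.inr 0 => Sum.inl (1, Strand.over)
        | Sum.inl (1, Strand.over) => Sum.inl (0, Strand.over)
        | Sum.inl (0, Strand.over) => Sum.inr 0
        | Sum.inr 1 => Sum.inl (2, Strand.over)
        | Sum.inl (2, Strand.over) => Sum.inl (0, Strand.under)
        | Sum.inl (0, Strand.under) => Sum.inr 1
        | Sum.inr 2 => Sum.inl (2, Strand.under)
        | Sum.inl (2, Strand.under) => Sum.inl (1, Strand.under)
        | Sum.inl (1, Strand.under) => Sum.inr 2
      left_inv := by unfold Function.LeftInverse; decide
      right_inv := by unfold Function.RightInverse Function.LeftInverse; decide }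

/-- `Γ'` is obtained from `Γ` by the primary MP move. -/
def Move {I O : Type} (Γ Γ' : OGraph I O) : Prop := OGraph.LocalMove left right Γ Γ'

end PrimaryMP

/-! ### Local pure sliding moves -/

/-- A local pure sliding move: a pure sliding move on the left side of an MP move `base`, whose
condition holds in the circuit diagram of this local diagram with two crossings already, and that is
the first move in a decomposition `base = N⁻¹ ∘ (pure sliding move)` with an MP move `N`. -/
structure LocalPSMove where
  base : MPMove
  kind : PSKind
  l : base.left.Edge
  r : base.left.Edge
  canSlide : base.left.CanSlide kind l r
  completes : ∃ N : MPMove, N.Move base.right (base.left.slide kind l r)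

namespace LocalPSMove

/-- `Γ'` is obtained from `Γ` by the local pure sliding move `x`. -/
def Move (x : LocalPSMove) {I O : Type} (Γ Γ' : OGraph I O) : Prop :=
  OGraph.LocalMove x.base.left (x.base.left.slide x.kind x.l x.r) Γ Γ'

end LocalPSMove

/-- `Γ` and `Γ'` are related by a sequence of moves, each of which is the move `B`, a move from the
set `A` of local pure sliding moves, or the inverse of one of these. -/
def Derivable (B : ∀ {I O : Type}, OGraph I O → OGraph I O → Prop) (A : Set LocalPSMove)
    {I O : Type} (Γ Γ' : OGraph I O) : Prop :=
  Relation.EqvGen (fun Δ Δ' : OGraph I O => B Δ Δ' ∨ ∃ x ∈ A, x.Move Δ Δ') Γ Γ'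

/-! Regard the 16 MP moves as vertices of a graph, with an edge from N to M whenever M = N⁻¹ ∘ x for
a local pure sliding move x on the left side of M. Along such an edge M is derivable from N and x,
in every context, because local moves can be performed inside larger diagrams
(`LocalMove.trans_part`). The edges come from the ordered 4-simplex. Let N have the opposite
orientation to M, and let its two left tetrahedra be disjoint from those of M; one tetrahedron k
remains. The left side of N then has the same labels and signs as two of the three crossings on the
right side of M. Applying N there leaves the two crossings of the left side of M and two copies of k
with opposite signs. In the cases chosen, this pair is the one created by a pure sliding move; that
is a finite check. These edges contain two disjoint directed cycles of length 8, one edge entering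
each MP move, and two bridges, one from each cycle to the other: 16 + 2 = 18 slides. From any root,
follow its own cycle, cross the bridge to the other cycle and follow that one. This spanning tree
has one edge for each of the other 15 moves. The primary MP move is one of the 16, up to the names
of its crossings and ends. -/

namespace OGraph

/-! ### Local moves without reference to a context -/

variable {I O J Q : Type}

/-- Every edge that enters the diagram `T` arrives at a crossing of `T`. -/
def Proper (T : OGraph J Q) : Prop := ∀ j, ∃ w, T.next (Sum.inr j) = Sum.inl w

theorem Proper.exit {T : OGraph J Q} (hT : T.Proper) (q : Q) :
    ∃ w, T.next (Sum.inl w) = Sum.inr q := by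
  rcases h : T.next.symm (Sum.inr q) with w | j
  · exact ⟨w, by rw [← h, Equiv.apply_symm_apply]⟩
  · obtain ⟨w, hw⟩ := hT j
    rw [← h, Equiv.apply_symm_apply] at hw
    cases hw

/-- Corresponding starts of edges, before and after `L` is replaced by `R` in a diagram whose other
crossings are indexed by `K`. -/
inductive StartRel (I : Type) (L R : OGraph J Q) {X X' K : Type}
    (ι : K ⊕ L.V → X) (ι' : K ⊕ R.V → X') :
    (X × Strand) ⊕ I → (X' × Strand) ⊕ I → Prop
  | outer (k : K) (s : Strand) :
      StartRel I L R ι ι' (Sum.inl (ι (Sum.inl k), s)) (Sum.inl (ι' (Sum.inl k), s))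
  | exit {q : Q} {w : L.V × Strand} {w' : R.V × Strand} (h : L.next (Sum.inl w) = Sum.inr q)
      (h' : R.next (Sum.inl w') = Sum.inr q) :
      StartRel I L R ι ι' (Sum.inl (ι (Sum.inr w.1), w.2)) (Sum.inl (ι' (Sum.inr w'.1), w'.2))
  | entry (i : I) : StartRel I L R ι ι' (Sum.inr i) (Sum.inr i)

/-- Corresponding ends of edges, before and after `L` is replaced by `R` in a diagram whose other
crossings are indexed by `K`. -/
inductive EndRel (O : Type) (L R : OGraph J Q) {X X' K : Type}
    (ι : K ⊕ L.V → X) (ι' : K ⊕ R.V → X') :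
    (X × Strand) ⊕ O → (X' × Strand) ⊕ O → Prop
  | outer (k : K) (s : Strand) :
      EndRel O L R ι ι' (Sum.inl (ι (Sum.inl k), s)) (Sum.inl (ι' (Sum.inl k), s))
  | entry {j : J} {w : L.V × Strand} {w' : R.V × Strand} (h : L.next (Sum.inr j) = Sum.inl w)
      (h' : R.next (Sum.inr j) = Sum.inl w') :
      EndRel O L R ι ι' (Sum.inl (ι (Sum.inr w.1), w.2)) (Sum.inl (ι' (Sum.inr w'.1), w'.2))
  | exit (o : O) : EndRel O L R ι ι' (Sum.inr o) (Sum.inr o)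

/-- `T` is a part of `Γ`, with crossings given by `f`. -/
structure IsPart (T : OGraph J Q) (Γ : OGraph I O) (f : T.V → Γ.V) : Prop where
  pos : ∀ v, Γ.pos (f v) = T.pos v
  next : ∀ w w', T.next (Sum.inl w) = Sum.inl w' →
    Γ.next (Sum.inl (f w.1, w.2)) = Sum.inl (f w'.1, w'.2)

/-- `Γ'` arises from `Γ` when the part `L` is replaced by `R`; the other crossings of both diagrams
are indexed by `K`. -/
structure Rewires (L R : OGraph J Q) (Γ Γ' : OGraph I O) {K : Type}
    (ι : K ⊕ L.V → Γ.V) (ι' : K ⊕ R.V → Γ'.V) : Prop where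
  bij : Function.Bijective ι
  bij' : Function.Bijective ι'
  pos : ∀ k, Γ.pos (ι (Sum.inl k)) = Γ'.pos (ι' (Sum.inl k))
  part : L.IsPart Γ (ι ∘ Sum.inr)
  part' : R.IsPart Γ' (ι' ∘ Sum.inr)
  next : ∀ x x', StartRel I L R ι ι' x x' → EndRel O L R ι ι' (Γ.next x) (Γ'.next x')

/-- Each edge of the context `C` becomes an edge of both diagrams. Properness makes its
prolongations end at a crossing of `L` and of `R`, so the gluing clauses apply to it. -/
theorem LocalMove.exists_rewires {L R : OGraph J Q} (hL : L.Proper) (hR : R.Proper)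
    {Γ Γ' : OGraph I O} (h : LocalMove L R Γ Γ') :
    ∃ (K : Type) (ι : K ⊕ L.V → Γ.V) (ι' : K ⊕ R.V → Γ'.V), Rewires L R Γ Γ' ι ι' := by
  obtain ⟨C, ⟨ι, hC, hL1, hL2, hL3⟩, ⟨ι', hC', hR1, hR2, hR3⟩⟩ := h
  have key : ∀ (a : (C.V × Strand) ⊕ (Q ⊕ I)) (x : (Γ.V × Strand) ⊕ I) (x' : (Γ'.V × Strand) ⊕ I),
      (match a with
        | Sum.inl (v, s) => x = Sum.inl (ι (Sum.inl v), s)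
        | Sum.inr (Sum.inl q) =>
            ∃ v s, L.next (Sum.inl (v, s)) = Sum.inr q ∧ x = Sum.inl (ι (Sum.inr v), s)
        | Sum.inr (Sum.inr i) => x = Sum.inr i) →
      (match a with
        | Sum.inl (v, s) => x' = Sum.inl (ι' (Sum.inl v), s)
        | Sum.inr (Sum.inl q) =>
            ∃ v s, R.next (Sum.inl (v, s)) = Sum.inr q ∧ x' = Sum.inl (ι' (Sum.inr v), s)
        | Sum.inr (Sum.inr i) => x' = Sum.inr i) →
      EndRel O L R ι ι' (Γ.next x) (Γ'.next x') := by
    intro a x x' hx hx'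
    rcases hb : C.next a with ⟨v, s⟩ | j | o
    · rw [hL3 a x (Sum.inl (ι (Sum.inl v), s)) hx (by rw [hb]),
        hR3 a x' (Sum.inl (ι' (Sum.inl v), s)) hx' (by rw [hb])]
      exact .outer v s
    · obtain ⟨w, hw⟩ := hL j
      obtain ⟨w', hw'⟩ := hR j
      rw [hL3 a x (Sum.inl (ι (Sum.inr w.1), w.2)) hx (by rw [hb]; exact ⟨_, _, hw, rfl⟩),
        hR3 a x' (Sum.inl (ι' (Sum.inr w'.1), w'.2)) hx' (by rw [hb]; exact ⟨_, _, hw', rfl⟩)]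
      exact .entry hw hw'
    · rw [hL3 a x (Sum.inr o) hx (by rw [hb]), hR3 a x' (Sum.inr o) hx' (by rw [hb])]
      exact .exit o
  refine ⟨C.V, ι, ι', ι.bijective, ι'.bijective, fun k => (hC k).trans (hC' k).symm,
    ⟨hL1, fun w w' => hL2 _ _ _ _⟩, ⟨hR1, fun w w' => hR2 _ _ _ _⟩, ?_⟩
  rintro _ _ (⟨k, s⟩ | ⟨h, h'⟩ | i)
  · exact key (Sum.inl (k, s)) _ _ rfl rfl
  · exact key (Sum.inr (Sum.inl _)) _ _ ⟨_, _, h, rfl⟩ ⟨_, _, h', rfl⟩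
  · exact key (Sum.inr (Sum.inr i)) _ _ rfl rfl

/-- The context is recovered by cutting `L` out of `Γ`. The compatibility of `next` in the two
diagrams says that cutting `R` out of `Γ'` leaves the same context. With `exists_rewires` this turns
a local move into a condition that can be checked on finite diagrams. -/
theorem Rewires.localMove {L R : OGraph J Q} (hL : L.Proper) (hR : R.Proper)
    {Γ Γ' : OGraph I O} {K : Type} {ι : K ⊕ L.V → Γ.V} {ι' : K ⊕ R.V → Γ'.V}
    (h : Rewires L R Γ Γ' ι ι') : LocalMove L R Γ Γ' := by
  choose lx hlx using hL.exit
  choose rx hrx using hR.exit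
  choose le hle using hL
  choose re hre using hR
  have lx_uniq : ∀ w q, L.next (Sum.inl w) = Sum.inr q → w = lx q := fun w q hw =>
    Sum.inl_injective (L.next.injective (hw.trans (hlx q).symm))
  have rx_uniq : ∀ w q, R.next (Sum.inl w) = Sum.inr q → w = rx q := fun w q hw =>
    Sum.inl_injective (R.next.injective (hw.trans (hrx q).symm))
  have le_uniq : ∀ j w, L.next (Sum.inr j) = Sum.inl w → w = le j := fun j w hw =>
    Sum.inl_injective (hw.symm.trans (hle j))
  have re_uniq : ∀ j w, R.next (Sum.inr j) = Sum.inl w → w = re j := fun j w hw =>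
    Sum.inl_injective (hw.symm.trans (hre j))
  -- `σ`, `σ'` place the starts of context edges in the two diagrams, `τ`, `τ'` their ends.
  let σ : (K × Strand) ⊕ (Q ⊕ I) → (Γ.V × Strand) ⊕ I :=
    Sum.elim (fun k => Sum.inl (ι (Sum.inl k.1), k.2))
      (Sum.map (fun q => (ι (Sum.inr (lx q).1), (lx q).2)) id)
  let σ' : (K × Strand) ⊕ (Q ⊕ I) → (Γ'.V × Strand) ⊕ I :=
    Sum.elim (fun k => Sum.inl (ι' (Sum.inl k.1), k.2))
      (Sum.map (fun q => (ι' (Sum.inr (rx q).1), (rx q).2)) id)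
  let τ : (K × Strand) ⊕ (J ⊕ O) → (Γ.V × Strand) ⊕ O :=
    Sum.elim (fun k => Sum.inl (ι (Sum.inl k.1), k.2))
      (Sum.map (fun j => (ι (Sum.inr (le j).1), (le j).2)) id)
  let τ' : (K × Strand) ⊕ (J ⊕ O) → (Γ'.V × Strand) ⊕ O :=
    Sum.elim (fun k => Sum.inl (ι' (Sum.inl k.1), k.2))
      (Sum.map (fun j => (ι' (Sum.inr (re j).1), (re j).2)) id)
  have hσ : σ.Injective := by
    rintro (⟨k, s⟩ | q | i) (⟨k', s'⟩ | q' | i') hh <;>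
      simp only [σ, Sum.elim_inl, Sum.elim_inr, Sum.map_inl, Sum.map_inr, Sum.inl.injEq,
        Sum.inr.injEq, Prod.mk.injEq, h.bij.injective.eq_iff, reduceCtorEq, false_and, id] at hh
    · rw [hh.1, hh.2]
    · have := hlx q
      rw [Prod.ext hh.1 hh.2, hlx q'] at this
      rw [Sum.inr_injective this]
    · rw [hh]
  have hτ : τ.Injective := by
    rintro (⟨k, s⟩ | q | i) (⟨k', s'⟩ | q' | i') hh <;>
      simp only [τ, Sum.elim_inl, Sum.elim_inr, Sum.map_inl, Sum.map_inr, Sum.inl.injEq,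
        Sum.inr.injEq, Prod.mk.injEq, h.bij.injective.eq_iff, reduceCtorEq, false_and, id] at hh
    · rw [hh.1, hh.2]
    · have := hle q
      rw [Prod.ext hh.1 hh.2, ← hle q'] at this
      rw [Sum.inr_injective (L.next.injective this)]
    · rw [hh]
  -- One `b` serves both diagrams, so a single map `f` describes the context edges on both sides.
  have hf : ∀ a, ∃ b, Γ.next (σ a) = τ b ∧ Γ'.next (σ' a) = τ' b := by
    have hE : ∀ y y', EndRel O L R ι ι' y y' → ∃ b, y = τ b ∧ y' = τ' b := by
      rintro _ _ (⟨k, s⟩ | ⟨hj, hj'⟩ | o)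
      · exact ⟨Sum.inl (k, s), rfl, rfl⟩
      · rw [le_uniq _ _ hj, re_uniq _ _ hj']
        exact ⟨Sum.inr (Sum.inl _), rfl, rfl⟩
      · exact ⟨Sum.inr (Sum.inr o), rfl, rfl⟩
    intro a
    apply hE
    apply h.next
    rcases a with ⟨k, s⟩ | q | i
    · exact .outer k s
    · exact .exit (hlx q) (hrx q)
    · exact .entry i
  choose f hf hf' using hf
  have hfi : f.Injective := fun a a' haa =>
    hσ (Γ.next.injective (by rw [hf, hf, haa]))
  have hfs : f.Surjective := by
    intro b
    suffices ∃ a, Γ.next.symm (τ b) = σ a by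
      obtain ⟨a, ha⟩ := this
      refine ⟨a, hτ ?_⟩
      rw [← hf, ← ha, Equiv.apply_symm_apply]
    rcases hx : Γ.next.symm (τ b) with ⟨v, s⟩ | i
    · obtain ⟨k | v, rfl⟩ := h.bij.surjective v
      · exact ⟨Sum.inl (k, s), rfl⟩
      · rcases hw : L.next (Sum.inl (v, s)) with w | q
        · exfalso
          have h1 := h.part.next _ _ hw
          have h2 := (Equiv.symm_apply_eq _).1 hx
          simp only [Function.comp] at h1
          rw [h1] at h2
          rcases b with ⟨k, s⟩ | j | o <;>
            simp only [τ, Sum.elim_inl, Sum.elim_inr, Sum.map_inl, Sum.map_inr, Sum.inl.injEq,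
              Prod.mk.injEq, h.bij.injective.eq_iff, reduceCtorEq, false_and, Sum.inr.injEq] at h2
          have h3 := hle j
          rw [Prod.ext h2.1 h2.2, ← hw] at h3
          exact absurd (L.next.injective h3) (by simp)
        · refine ⟨Sum.inr (Sum.inl q), ?_⟩
          simp [σ, ← lx_uniq _ _ hw]
    · exact ⟨Sum.inr (Sum.inr i), rfl⟩
  obtain ⟨g, hg⟩ : ∃ g : (K × Strand) ⊕ (Q ⊕ I) ≃ (K × Strand) ⊕ (J ⊕ O), ∀ a, g a = f a :=
    ⟨Equiv.ofBijective f ⟨hfi, hfs⟩, fun _ => rfl⟩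
  have hK : Finite K := by
    have := Γ.fin
    exact Finite.of_injective _ (h.bij.injective.comp Sum.inl_injective)
  refine ⟨⟨K, hK, fun k => Γ.pos (ι (Sum.inl k)), g⟩,
    ⟨Equiv.ofBijective ι h.bij, fun _ => rfl, h.part.pos,
      fun v s w t hh => h.part.next (v, s) (w, t) hh, ?_⟩,
    ⟨Equiv.ofBijective ι' h.bij', fun k => (h.pos k).symm, h.part'.pos,
      fun v s w t hh => h.part'.next (v, s) (w, t) hh, ?_⟩⟩
  · intro a x y hx hy
    have hxa : x = σ a := by
      rcases a with ⟨k, s⟩ | q | i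
      · exact hx
      · obtain ⟨v, s, hv, rfl⟩ := hx
        simp [σ, ← lx_uniq _ _ hv]
      · exact hx
    have hyb : y = τ (f a) := by
      dsimp only at hy
      rw [hg] at hy
      rcases hb : f a with ⟨k, s⟩ | j | o <;> rw [hb] at hy
      · exact hy
      · obtain ⟨v, s, hv, rfl⟩ := hy
        simp [τ, ← le_uniq _ _ hv]
      · exact hy
    rw [hxa, hyb, hf]
  · intro a x y hx hy
    have hxa : x = σ' a := by
      rcases a with ⟨k, s⟩ | q | i
      · exact hx
      · obtain ⟨v, s, hv, rfl⟩ := hx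
        simp [σ', ← rx_uniq _ _ hv]
      · exact hx
    have hyb : y = τ' (f a) := by
      dsimp only at hy
      rw [hg] at hy
      rcases hb : f a with ⟨k, s⟩ | j | o <;> rw [hb] at hy
      · exact hy
      · obtain ⟨v, s, hv, rfl⟩ := hy
        simp [τ', ← re_uniq _ _ hv]
      · exact hy
    rw [hxa, hyb, hf']

/-! ### Gluing into contexts, and locality of moves -/

/-- A proper diagram can be put into every context. -/
theorem exists_isGlued (C : OGraph (Q ⊕ I) (J ⊕ O)) {T : OGraph J Q} (hT : T.Proper) :
    ∃ Γ : OGraph I O, IsGlued C T Γ := by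
  choose tx htx using hT.exit
  choose te hte using hT
  have tx_uniq : ∀ w q, T.next (Sum.inl w) = Sum.inr q → w = tx q := fun w q hw =>
    Sum.inl_injective (T.next.injective (hw.trans (htx q).symm))
  have te_uniq : ∀ j w, T.next (Sum.inr j) = Sum.inl w → w = te j := fun j w hw =>
    Sum.inl_injective (hw.symm.trans (hte j))
  let τ : (C.V × Strand) ⊕ (J ⊕ O) → ((C.V ⊕ T.V) × Strand) ⊕ O :=
    Sum.elim (fun k => Sum.inl (Sum.inl k.1, k.2))
      (Sum.map (fun j => (Sum.inr (te j).1, (te j).2)) id)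
  have hτ : τ.Injective := by
    rintro (⟨k, s⟩ | q | i) (⟨k', s'⟩ | q' | i') hh <;>
      simp only [τ, Sum.elim_inl, Sum.elim_inr, Sum.map_inl, Sum.map_inr, Sum.inl.injEq,
        Sum.inr.injEq, Prod.mk.injEq, reduceCtorEq, false_and, id] at hh
    · rw [hh.1, hh.2]
    · have := hte q
      rw [Prod.ext hh.1 hh.2, ← hte q'] at this
      rw [Sum.inr_injective (T.next.injective this)]
    · rw [hh]
  have hτT : ∀ u w b, T.next (Sum.inl u) = Sum.inl w → τ b ≠ Sum.inl (Sum.inr w.1, w.2) := by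
    intro u w b hu hb
    rcases b with ⟨k, s⟩ | j | o <;>
      simp only [τ, Sum.elim_inl, Sum.elim_inr, Sum.map_inl, Sum.map_inr, Sum.inl.injEq,
        Prod.mk.injEq, reduceCtorEq, false_and, Sum.inr.injEq] at hb
    have h3 := hte j
    rw [Prod.ext hb.1 hb.2, ← hu] at h3
    exact absurd (T.next.injective h3) (by simp)
  -- Follow an edge of `T`; if it leaves `T`, continue along `C`. An arrival at an entry of `T` is
  -- prolonged by `τ`. One pass suffices, since no edge runs straight through `T`.
  let F : ((C.V ⊕ T.V) × Strand) ⊕ I → ((C.V ⊕ T.V) × Strand) ⊕ O :=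
    Sum.elim (fun x => match x with
        | (Sum.inl v, s) => τ (C.next (Sum.inl (v, s)))
        | (Sum.inr v, s) => Sum.elim (fun w => Sum.inl (Sum.inr w.1, w.2))
            (fun q => τ (C.next (Sum.inr (Sum.inl q)))) (T.next (Sum.inl (v, s))))
      (fun i => τ (C.next (Sum.inr (Sum.inr i))))
  -- every start is internal to `T` or comes from the context
  let σ : (C.V × Strand) ⊕ (Q ⊕ I) → ((C.V ⊕ T.V) × Strand) ⊕ I :=
    Sum.elim (fun k => Sum.inl (Sum.inl k.1, k.2))
      (Sum.map (fun q => (Sum.inr (tx q).1, (tx q).2)) id)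
  have hFσ : ∀ a, F (σ a) = τ (C.next a) := by
    rintro (⟨k, s⟩ | q | i)
    · rfl
    · simp [F, σ, htx]
    · rfl
  have hFT : ∀ u w, T.next (Sum.inl u) = Sum.inl w →
      F (Sum.inl (Sum.inr u.1, u.2)) = Sum.inl (Sum.inr w.1, w.2) := by
    rintro ⟨v, s⟩ w hu
    simp [F, hu]
  have hcases : ∀ x, (∃ a, x = σ a) ∨
      ∃ u w, T.next (Sum.inl u) = Sum.inl w ∧ x = Sum.inl (Sum.inr u.1, u.2) := by
    rintro (⟨k | v, s⟩ | i)
    · exact .inl ⟨Sum.inl (k, s), rfl⟩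
    · rcases hw : T.next (Sum.inl (v, s)) with w | q
      · exact .inr ⟨_, _, hw, rfl⟩
      · refine .inl ⟨Sum.inr (Sum.inl q), ?_⟩
        simp [σ, ← tx_uniq _ _ hw]
    · exact .inl ⟨Sum.inr (Sum.inr i), rfl⟩
  have hFi : F.Injective := by
    intro x x' hh
    obtain ⟨a, rfl⟩ | ⟨u, w, hu, rfl⟩ := hcases x <;>
      obtain ⟨a', rfl⟩ | ⟨u', w', hu', rfl⟩ := hcases x'
    · rw [hFσ, hFσ] at hh
      rw [C.next.injective (hτ hh)]
    · rw [hFσ, hFT _ _ hu'] at hh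
      exact absurd hh (hτT _ _ _ hu')
    · rw [hFσ, hFT _ _ hu] at hh
      exact absurd hh.symm (hτT _ _ _ hu)
    · rw [hFT _ _ hu, hFT _ _ hu'] at hh
      simp only [Sum.inl.injEq, Prod.mk.injEq, Sum.inr.injEq] at hh
      rw [Prod.ext hh.1 hh.2, ← hu'] at hu
      rw [Sum.inl_injective (T.next.injective hu)]
  have hFs : F.Surjective := by
    have hb : ∀ b, ∃ x, F x = τ b := fun b =>
      ⟨σ (C.next.symm b), by rw [hFσ, Equiv.apply_symm_apply]⟩
    rintro (⟨k | v, s⟩ | o)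
    · exact hb (Sum.inl (k, s))
    · rcases hx : T.next.symm (Sum.inl (v, s)) with u | j
      · exact ⟨_, hFT u (v, s) (by rw [← hx, Equiv.apply_symm_apply])⟩
      · have := hb (Sum.inr (Sum.inl j))
        rwa [show τ (Sum.inr (Sum.inl j)) = Sum.inl (Sum.inr v, s) by
          simp [τ, ← te_uniq j (v, s) (by rw [← hx, Equiv.apply_symm_apply])]] at this
    · exact hb (Sum.inr (Sum.inr o))
  have hfin : Finite (C.V ⊕ T.V) := by
    have := C.fin
    have := T.fin
    infer_instance
  refine ⟨⟨C.V ⊕ T.V, hfin, Sum.elim C.pos T.pos, Equiv.ofBijective F ⟨hFi, hFs⟩⟩,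
    Equiv.refl _, fun _ => rfl, fun _ => rfl, fun v s w t hh => hFT (v, s) (w, t) hh, ?_⟩
  intro a x y hx hy
  have hxa : x = σ a := by
    rcases a with ⟨k, s⟩ | q | i
    · exact hx
    · obtain ⟨v, s, hv, rfl⟩ := hx
      simp [σ, ← tx_uniq _ _ hv]
    · exact hx
  have hyb : y = τ (C.next a) := by
    rcases hb : C.next a with ⟨k, s⟩ | j | o <;> rw [hb] at hy
    · exact hy
    · obtain ⟨v, s, hv, rfl⟩ := hy
      simp [τ, ← te_uniq _ _ hv]
    · exact hy
  rw [hxa, hyb]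
  exact hFσ a

/-- A local move on a part of a diagram is a local move on the diagram. -/
theorem LocalMove.trans_part {J' Q' : Type} {A B : OGraph J' Q'} {T T' : OGraph J Q}
    {Γ Γ' : OGraph I O} (hA : A.Proper) (hB : B.Proper) (hT : T.Proper) (hT' : T'.Proper)
    (h₁ : LocalMove A B T T') (h₂ : LocalMove T T' Γ Γ') : LocalMove A B Γ Γ' := by
  obtain ⟨K₁, ι₁, ι₁', h₁⟩ := h₁.exists_rewires hA hB
  obtain ⟨K₂, ι₂, ι₂', h₂⟩ := h₂.exists_rewires hT hT'
  have comp_bij : ∀ {V W X : Type} {f : K₁ ⊕ V → W} {g : K₂ ⊕ W → X}, f.Bijective → g.Bijective →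
      (g ∘ Sum.map id f ∘ Equiv.sumAssoc K₂ K₁ V).Bijective := fun hf hg =>
    hg.comp ((Sum.map_bijective.2 ⟨Function.bijective_id, hf⟩).comp (Equiv.bijective _))
  refine Rewires.localMove hA hB (K := K₂ ⊕ K₁) (ι := ι₂ ∘ Sum.map id ι₁ ∘ Equiv.sumAssoc _ _ _)
    (ι' := ι₂' ∘ Sum.map id ι₁' ∘ Equiv.sumAssoc _ _ _) ⟨comp_bij h₁.bij h₂.bij,
      comp_bij h₁.bij' h₂.bij', ?_, ⟨?_, ?_⟩, ⟨?_, ?_⟩, ?_⟩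
  · rintro (k | k)
    · exact h₂.pos k
    · exact (h₂.part.pos _).trans ((h₁.pos k).trans (h₂.part'.pos _).symm)
  · exact fun v => (h₂.part.pos _).trans (h₁.part.pos v)
  · exact fun w w' hw => h₂.part.next _ _ (h₁.part.next _ _ hw)
  · exact fun v => (h₂.part'.pos _).trans (h₁.part'.pos v)
  · exact fun w w' hw => h₂.part'.next _ _ (h₁.part'.next _ _ hw)
  -- The edge is traced in stages: `lift` carries corresponding ends inside `T` over to `Γ`, `outer`
  -- treats edges that start outside or leave `T`, and `inner` those that start at a crossing of
  -- `T`.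
  have lift : ∀ w w', EndRel Q A B ι₁ ι₁' (Sum.inl w) (Sum.inl w') →
      EndRel O A B (ι₂ ∘ Sum.map id ι₁ ∘ Equiv.sumAssoc K₂ K₁ A.V)
        (ι₂' ∘ Sum.map id ι₁' ∘ Equiv.sumAssoc K₂ K₁ B.V)
        (Sum.inl (ι₂ (Sum.inr w.1), w.2)) (Sum.inl (ι₂' (Sum.inr w'.1), w'.2)) := by
    rintro w w' (⟨k, s⟩ | ⟨h, h'⟩ | _)
    · exact .outer (Sum.inr k) s
    · exact .entry h h'
  have outer : ∀ x x', StartRel I T T' ι₂ ι₂' x x' →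
      EndRel O A B (ι₂ ∘ Sum.map id ι₁ ∘ Equiv.sumAssoc K₂ K₁ A.V)
        (ι₂' ∘ Sum.map id ι₁' ∘ Equiv.sumAssoc K₂ K₁ B.V) (Γ.next x) (Γ'.next x') := by
    intro x x' hx
    have := h₂.next x x' hx
    generalize Γ.next x = y at this
    generalize Γ'.next x' = y' at this
    rcases this with ⟨k, s⟩ | ⟨h, h'⟩ | o
    · exact .outer (Sum.inl k) s
    · apply lift
      rw [← h, ← h']
      exact h₁.next _ _ (.entry _)
    · exact .exit o
  have inner : ∀ w w', StartRel J A B ι₁ ι₁' (Sum.inl w) (Sum.inl w') →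
      EndRel O A B (ι₂ ∘ Sum.map id ι₁ ∘ Equiv.sumAssoc K₂ K₁ A.V)
        (ι₂' ∘ Sum.map id ι₁' ∘ Equiv.sumAssoc K₂ K₁ B.V)
        (Γ.next (Sum.inl (ι₂ (Sum.inr w.1), w.2))) (Γ'.next (Sum.inl (ι₂' (Sum.inr w'.1), w'.2))) := by
    intro w w' hw
    have := h₁.next _ _ hw
    rcases hy : T.next (Sum.inl w) with u | q <;> rcases hy' : T'.next (Sum.inl w') with u' | q' <;>
      rw [hy, hy'] at this
    · have e := h₂.part.next _ _ hy
      have e' := h₂.part'.next _ _ hy'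
      simp only [Function.comp_apply] at e e'
      rw [e, e']
      exact lift _ _ this
    · cases this
    · cases this
    · cases this
      exact outer _ _ (.exit hy hy')
  rintro _ _ (⟨k | k, s⟩ | ⟨h, h'⟩ | i)
  · exact outer _ _ (.outer k s)
  · exact inner (ι₁ (Sum.inl k), s) (ι₁' (Sum.inl k), s) (.outer k s)
  · exact inner _ _ (.exit h h')
  · exact outer _ _ (.entry i)

end OGraph

namespace OGraph

variable {I O J Q K : Type}

/-! ### Deciding whether a given rewiring is correct -/

section Decidability

variable {L R : OGraph J Q} {Γ Γ' : OGraph I O} {X X' : Type} {ι : K ⊕ L.V → X} {ι' : K ⊕ R.V → X'}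

instance EndRel.decidable [Fintype K] [Fintype L.V] [Fintype R.V] [Fintype J] [DecidableEq L.V]
    [DecidableEq R.V] [DecidableEq Q] [DecidableEq O] [DecidableEq X] [DecidableEq X'] :
    ∀ (y : (X × Strand) ⊕ O) (y' : (X' × Strand) ⊕ O), Decidable (EndRel O L R ι ι' y y')
  | Sum.inl (x, s), Sum.inl (x', s') =>
      decidable_of_iff ((s = s' ∧ ∃ k, ι (Sum.inl k) = x ∧ ι' (Sum.inl k) = x') ∨
        ∃ v, ι (Sum.inr v) = x ∧ ∃ v', ι' (Sum.inr v') = x' ∧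
          ∃ j, L.next (Sum.inr j) = Sum.inl (v, s) ∧ R.next (Sum.inr j) = Sum.inl (v', s')) <| by
        constructor
        · rintro (⟨rfl, k, rfl, rfl⟩ | ⟨v, rfl, v', rfl, j, h, h'⟩)
          · exact .outer k s
          · exact .entry h h'
        · rintro (⟨k, s⟩ | ⟨h, h'⟩)
          · exact .inl ⟨rfl, k, rfl, rfl⟩
          · exact .inr ⟨_, rfl, _, rfl, _, h, h'⟩
  | Sum.inr o, Sum.inr o' =>
      decidable_of_iff (o = o')
        ⟨fun h => h ▸ EndRel.exit o, fun h => by cases h; rfl⟩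
  | Sum.inl _, Sum.inr _ => isFalse nofun
  | Sum.inr _, Sum.inl _ => isFalse nofun

instance IsPart.decidable {T : OGraph J Q} {f : T.V → Γ.V} [Fintype T.V] [DecidableEq T.V]
    [DecidableEq Q] [DecidableEq Γ.V] [DecidableEq O] : Decidable (T.IsPart Γ f) :=
  decidable_of_iff ((∀ v, Γ.pos (f v) = T.pos v) ∧
    ∀ w w', T.next (Sum.inl w) = Sum.inl w' →
      Γ.next (Sum.inl (f w.1, w.2)) = Sum.inl (f w'.1, w'.2))
    ⟨fun h => ⟨h.1, h.2⟩, fun h => ⟨h.pos, h.next⟩⟩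

-- Splitting by the constructors of `StartRel` replaces the quantifier over all pairs of starts by
-- three finite ones.
set_option synthInstance.maxSize 1000 in
set_option synthInstance.maxHeartbeats 200000 in
instance Rewires.decidable {ι : K ⊕ L.V → Γ.V} {ι' : K ⊕ R.V → Γ'.V} [Fintype K] [Fintype L.V]
    [Fintype R.V] [Fintype J] [Fintype Q] [Fintype I] [Fintype Γ.V] [Fintype Γ'.V] [DecidableEq K]
    [DecidableEq L.V] [DecidableEq R.V] [DecidableEq Q] [DecidableEq O]
    [DecidableEq Γ.V] [DecidableEq Γ'.V] : Decidable (Rewires L R Γ Γ' ι ι') :=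
  decidable_of_iff (ι.Bijective ∧ ι'.Bijective ∧
    (∀ k, Γ.pos (ι (Sum.inl k)) = Γ'.pos (ι' (Sum.inl k))) ∧
    L.IsPart Γ (ι ∘ Sum.inr) ∧ R.IsPart Γ' (ι' ∘ Sum.inr) ∧
    (∀ k s, EndRel O L R ι ι' (Γ.next (Sum.inl (ι (Sum.inl k), s)))
      (Γ'.next (Sum.inl (ι' (Sum.inl k), s)))) ∧
    (∀ q w, L.next (Sum.inl w) = Sum.inr q → ∀ w', R.next (Sum.inl w') = Sum.inr q →
      EndRel O L R ι ι' (Γ.next (Sum.inl (ι (Sum.inr w.1), w.2)))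
        (Γ'.next (Sum.inl (ι' (Sum.inr w'.1), w'.2)))) ∧
    ∀ i, EndRel O L R ι ι' (Γ.next (Sum.inr i)) (Γ'.next (Sum.inr i))) <| by
    constructor
    · rintro ⟨h1, h2, h3, h4, h5, h6, h7, h8⟩
      refine ⟨h1, h2, h3, h4, h5, ?_⟩
      rintro _ _ (⟨k, s⟩ | ⟨h, h'⟩ | i)
      exacts [h6 k s, h7 _ _ h _ h', h8 i]
    · rintro ⟨h1, h2, h3, h4, h5, h6⟩
      exact ⟨h1, h2, h3, h4, h5, fun k s => h6 _ _ (.outer k s),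
        fun _ _ h _ h' => h6 _ _ (.exit h h'), fun i => h6 _ _ (.entry i)⟩

instance LineJoined.decidable [Fintype Γ.V] [DecidableEq Γ.V] [DecidableEq I]
    (x y : Γ.Edge × Fin 3) : Decidable (Γ.LineJoined x y) := by
  unfold LineJoined
  infer_instance

end Decidability

/-! ### Pure sliding moves, computably -/

variable (Γ : OGraph I O)

/-- A computable version of `insertPair`. -/
def crossTwice [DecidableEq Γ.V] [DecidableEq I] (a b : Γ.Edge) (c d : Bool) : OGraph I O where
  V := Γ.V ⊕ Bool
  fin := by
    have := Γ.fin
    infer_instance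
  pos := Sum.elim Γ.pos id
  next := ((Equiv.swap (Γ.oldEdge a) (Sum.inl (Sum.inr (!c), Strand.over))).trans
    (Equiv.swap (Γ.oldEdge b) (Sum.inl (Sum.inr (!d), Strand.under)))).trans Γ.addPair

/-- Only the decidability instances inside `Equiv.swap` differ, and these are unique. -/
theorem insertPair_eq_crossTwice [DecidableEq Γ.V] [DecidableEq I] (a b : Γ.Edge) (c d : Bool) :
    Γ.insertPair a b c d = Γ.crossTwice a b c d := by
  unfold insertPair crossTwice
  congr!

/-- A computable version of `slide`. -/
def slid [DecidableEq Γ.V] [DecidableEq I] (k : PSKind) (l r : Γ.Edge) : OGraph I O :=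
  Γ.crossTwice (if k.leftOver then l else r) (if k.leftOver then r else l) k.overFirst k.underFirst

theorem slide_eq_slid [DecidableEq Γ.V] [DecidableEq I] (k : PSKind) (l r : Γ.Edge) :
    Γ.slide k l r = Γ.slid k l r := by
  unfold slide slid
  split_ifs <;> exact Γ.insertPair_eq_crossTwice _ _ _ _

instance [Fintype Γ.V] [DecidableEq Γ.V] [DecidableEq I] (k : PSKind) (l r : Γ.Edge) :
    Fintype (Γ.slid k l r).V :=
  inferInstanceAs (Fintype (Γ.V ⊕ Bool))

instance [DecidableEq Γ.V] [DecidableEq I] (k : PSKind) (l r : Γ.Edge) :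
    DecidableEq (Γ.slid k l r).V :=
  inferInstanceAs (DecidableEq (Γ.V ⊕ Bool))

variable {Γ}

theorem Proper.slide (hΓ : Γ.Proper) (k : PSKind) (l r : Γ.Edge) : (Γ.slide k l r).Proper := by
  classical
  have key : ∀ a b c d, (Γ.insertPair a b c d).Proper := by
    intro a b c d j
    have h₀ : ∃ w, Γ.addPair (Sum.inr j) = Sum.inl w := by
      obtain ⟨w, hw⟩ := hΓ j
      exact ⟨Prod.map Sum.inl id w, by simp [addPair, hw]⟩
    -- If an entering edge is cut, its start is exchanged with one at a new crossing, whose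
    -- successor in `addPair` is again a new crossing.
    have h₁ : ∀ e s, ∃ w, Γ.addPair (Sum.inl (Sum.inr e, s)) = Sum.inl w := fun e s => ⟨_, rfl⟩
    change ∃ w, Γ.addPair (Equiv.swap _ _ (Equiv.swap _ _ (Sum.inr j))) = Sum.inl w
    rw [Equiv.swap_apply_def (Γ.oldEdge a), Equiv.swap_apply_def]
    split_ifs <;> first | exact h₀ | exact h₁ _ _ | simp_all
  unfold OGraph.slide
  split_ifs <;> exact key _ _ _ _

/-- A chain of two joins is decidable, unlike the generated equivalence as defined, and is enough
for all the slides used here. -/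
theorem CanSlide.of_joined {k : PSKind} {l r : Γ.Edge} (h : l ≠ r)
    (h' : ∃ z, Γ.LineJoined (l, k.leftLine) z ∧ Γ.LineJoined z (r, k.rightLine)) :
    Γ.CanSlide k l r := by
  obtain ⟨z, h₁, h₂⟩ := h'
  exact ⟨h, .trans _ _ _ (.rel _ _ h₁) (.rel _ _ h₂)⟩

end OGraph

/-! ### Decompositions of MP moves as finite checks -/

namespace MPMove

instance (m : MPMove) : Fintype m.left.V := inferInstanceAs (Fintype {k // m.isLeft k = true})
instance (m : MPMove) : Fintype m.right.V := inferInstanceAs (Fintype {k // m.isLeft k = false})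
instance (m : MPMove) : DecidableEq m.left.V :=
  inferInstanceAs (DecidableEq {k // m.isLeft k = true})
instance (m : MPMove) : DecidableEq m.right.V :=
  inferInstanceAs (DecidableEq {k // m.isLeft k = false})

theorem left_proper (m : MPMove) : m.left.Proper := fun _ => ⟨_, rfl⟩

theorem right_proper (m : MPMove) : m.right.Proper := fun _ => ⟨_, rfl⟩

/-- The crossings of `m.right`, in terms of the crossings of `n.left` and the third one. -/
def outerIncl (m n : MPMove) (h : ∀ k, n.isLeft k = true → m.isLeft k = false) :
    {k // m.isLeft k = false ∧ n.isLeft k = false} ⊕ n.left.V → m.right.V :=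
  Sum.elim (fun k => ⟨k.1, k.2.1⟩) (fun k => ⟨k.1, h k.1 k.2⟩)

/-- The crossings of a diagram obtained from `m.left` by a pure sliding move, in terms of the
crossings of `n.right` and another one. -/
def slidIncl (m n : MPMove) (k : PSKind) (l r : m.left.Edge) :
    {k // m.isLeft k = false ∧ n.isLeft k = false} ⊕ n.right.V → (m.left.slid k l r).V :=
  -- The fifth tetrahedron occurs twice: as the crossing of `m.right` that is kept, and, for `n.ε =
  -- !m.ε`, with the opposite sign in `n.right`. These are the two new crossings of the slide.
  Sum.elim (fun k => Sum.inr (Simplex.sgn m.ε k.1))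
    (fun k => if h : m.isLeft k.1 = true then Sum.inl ⟨k.1, h⟩ else Sum.inr !(Simplex.sgn m.ε k.1))

/-- The pure sliding move of type `k` on the edges `l` and `r` of `m.left` can be performed, and
followed by the inverse of `n` it gives `m`. -/
def Decomposes (m n : MPMove) (k : PSKind) (l r : m.left.Edge) : Prop :=
  l ≠ r ∧
    (∃ z, m.left.LineJoined (l, k.leftLine) z ∧ m.left.LineJoined z (r, k.rightLine)) ∧
    ∃ h, OGraph.Rewires n.left n.right m.right (m.left.slid k l r) (m.outerIncl n h) (m.slidIncl n k l r)

instance (m n : MPMove) (k : PSKind) (l r : m.left.Edge) : Decidable (m.Decomposes n k l r) := by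
  have (h : ∀ k, n.isLeft k = true → m.isLeft k = false) :
      Decidable (OGraph.Rewires n.left n.right m.right (m.left.slid k l r) (m.outerIncl n h)
        (m.slidIncl n k l r)) :=
    OGraph.Rewires.decidable (Γ' := m.left.slid k l r)
  unfold Decomposes
  infer_instance

end MPMove

/-! ### The graph of decompositions: two cycles and two bridges -/

namespace MPMove

/-- An MP move, as a triple. -/
def equivTriple : MPMove ≃ {p : Fin 5 × Fin 5 × Bool //
    p.1 < p.2.1 ∧ ¬ (p.1 = 0 ∧ p.2.1 = 1) ∧ ¬ (p.1 = 3 ∧ p.2.1 = 4)} where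
  toFun m := ⟨(m.i, m.j, m.ε), m.lt, m.not_bump₀, m.not_bump₁⟩
  invFun p := ⟨p.1.1, p.1.2.1, p.1.2.2, p.2.1, p.2.2.1, p.2.2.2⟩

instance : DecidableEq MPMove := equivTriple.decidableEq

instance : Fintype MPMove := Fintype.ofEquiv _ equivTriple.symm

/-- The predecessor of an MP move in one of two cycles with eight elements each. -/
def pred (m : MPMove) : MPMove :=
  match m.i, m.j with
  | 0, 2 => ⟨1, 4, !m.ε, by decide, by decide, by decide⟩
  | 1, 3 => ⟨0, 2, !m.ε, by decide, by decide, by decide⟩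
  | 2, 4 => ⟨1, 3, !m.ε, by decide, by decide, by decide⟩
  | 0, 3 => ⟨2, 4, !m.ε, by decide, by decide, by decide⟩
  | 1, 2 => ⟨0, 3, !m.ε, by decide, by decide, by decide⟩
  | 0, 4 => ⟨1, 2, !m.ε, by decide, by decide, by decide⟩
  | 2, 3 => ⟨0, 4, !m.ε, by decide, by decide, by decide⟩
  -- Only the pair (1, 4) is left. Every step flips `ε`, so the 8-cycle of pairs lifts to two cycles
  -- of length 8.
  | _, _ => ⟨2, 3, !m.ε, by decide, by decide, by decide⟩

/-- The type of a pure sliding move that leads from the predecessor of an MP move to this move. -/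
def predKind (m : MPMove) : PSKind :=
  match m.i, m.j with
  | 0, 2 => .I
  | 0, 3 => .I
  | 1, 3 => .II
  | 2, 4 => .II
  | 0, 4 => .III
  | 1, 4 => .III
  | _, _ => .IV

theorem decomposes_pred : ∀ m : MPMove, ∃ l r, m.Decomposes m.pred m.predKind l r := by
  decide +kernel

/-- The move `M₁₄` with orientation `ε`, a member of one of the two cycles. -/
def bridge (ε : Bool) : MPMove := ⟨1, 4, ε, by decide, by decide, by decide⟩

/-- The move `M₀₃` with orientation `!ε`, which is not in the cycle of `bridge ε`. -/
def bridgePred (ε : Bool) : MPMove := ⟨0, 3, !ε, by decide, by decide, by decide⟩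

theorem decomposes_bridgePred :
    ∀ ε, ∃ l r, (bridge ε).Decomposes (bridgePred ε) PSKind.II l r := by
  decide +kernel

/-- An invariant that distinguishes the two cycles. -/
def cycle (m : MPMove) : Bool := (m.i == 2 || m.j == 2) == m.ε

/-- Whether the tree with root `m` reaches `n` by the bridge, and not inside a cycle. -/
def UsesBridge (m n : MPMove) : Prop := n = bridge n.ε ∧ n.cycle ≠ m.cycle

instance (m n : MPMove) : Decidable (m.UsesBridge n) := by
  unfold UsesBridge
  infer_instance

/-- The predecessor of `n` in a tree with root `m` that contains all MP moves. -/
def parent (m n : MPMove) : MPMove :=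
  if n = m then m else if m.UsesBridge n then bridgePred n.ε else n.pred

/-- At most 7 steps lead to the bridge in the other cycle, one crosses it, and at most 7 lead to the
root, which `parent m` fixes. -/
theorem iterate_parent : ∀ m n : MPMove, (parent m)^[15] n = m := by
  decide +kernel

end MPMove

/-! ### From decompositions to derivations -/

namespace LocalPSMove

/-- The move `x` followed by the inverse of `n` gives the move `x.base`. -/
def CompletedBy (x : LocalPSMove) (n : MPMove) : Prop :=
  n.Move x.base.right (x.base.left.slide x.kind x.l x.r)

/-- Put the slid diagram into the context of the given move: `Δ` is then reached from `Γ` by the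
slide, and from `Γ'` by `n`, which acts inside the part `x.base.right`. -/
theorem CompletedBy.exists_move {x : LocalPSMove} {n : MPMove} (h : x.CompletedBy n) {I O : Type}
    {Γ Γ' : OGraph I O} (hΓ : x.base.Move Γ Γ') : ∃ Δ, x.Move Γ Δ ∧ n.Move Γ' Δ := by
  obtain ⟨C, hL, hR⟩ := hΓ
  have hs := x.base.left_proper.slide x.kind x.l x.r
  obtain ⟨Δ, hΔ⟩ := OGraph.exists_isGlued C hs
  exact ⟨Δ, ⟨C, hL, hΔ⟩, OGraph.LocalMove.trans_part n.left_proper n.right_proper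
    x.base.right_proper hs h ⟨C, hR, hΔ⟩⟩

end LocalPSMove

theorem MPMove.Decomposes.exists_localPSMove {m n : MPMove} {k : PSKind} {l r : m.left.Edge}
    (h : m.Decomposes n k l r) : ∃ x : LocalPSMove, x.base = m ∧ x.kind = k ∧ x.CompletedBy n := by
  obtain ⟨h₁, h₂, h₃, h₄⟩ := h
  have hc : n.Move m.right (m.left.slide k l r) := by
    rw [OGraph.slide_eq_slid]
    exact h₄.localMove n.left_proper n.right_proper
  exact ⟨⟨m, k, l, r, .of_joined h₁ h₂, n, hc⟩, rfl, rfl, hc⟩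

/-- The step along one edge of the graph: do the slide, then undo `n`. -/
theorem Derivable.of_completedBy {B : ∀ {I O : Type}, OGraph I O → OGraph I O → Prop}
    {A : Set LocalPSMove} {x : LocalPSMove} {n : MPMove} (hx : x ∈ A) (h : x.CompletedBy n)
    (hn : ∀ (I O : Type) (Γ Γ' : OGraph I O), n.Move Γ Γ' → Derivable B A Γ Γ')
    (I O : Type) (Γ Γ' : OGraph I O) (hΓ : x.base.Move Γ Γ') : Derivable B A Γ Γ' := by
  obtain ⟨Δ, h₁, h₂⟩ := h.exists_move hΓ
  exact .trans _ Δ _ (.rel _ _ (.inr ⟨x, hx, h₁⟩)) (.symm _ _ (hn I O _ _ h₂))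

theorem Derivable.mono {B B' : ∀ {I O : Type}, OGraph I O → OGraph I O → Prop}
    {A : Set LocalPSMove} (hB : ∀ (I O : Type) (Γ Γ' : OGraph I O), B Γ Γ' → B' Γ Γ')
    {I O : Type} {Γ Γ' : OGraph I O} (h : Derivable B A Γ Γ') : Derivable B' A Γ Γ' :=
  Relation.EqvGen.mono (fun _ _ => Or.imp_left (hB I O _ _)) _ _ h

/-! ### The primary MP move -/

namespace PrimaryMP

instance : Fintype left.V := inferInstanceAs (Fintype (Fin 2))
instance : Fintype right.V := inferInstanceAs (Fintype (Fin 3))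
instance : DecidableEq left.V := inferInstanceAs (DecidableEq (Fin 2))
instance : DecidableEq right.V := inferInstanceAs (DecidableEq (Fin 3))

/-- The MP move that is the primary one. -/
def mpMove : MPMove := ⟨1, 3, true, by decide, by decide, by decide⟩

theorem left_proper : left.Proper := by
  unfold OGraph.Proper
  decide

theorem right_proper : right.Proper := by
  unfold OGraph.Proper
  decide

/-- The crossings of `left`, as crossings of `mpMove.left`. -/
def leftIncl : Empty ⊕ left.V → mpMove.left.V :=
  Sum.elim Empty.elim ![⟨3, rfl⟩, ⟨1, rfl⟩]

/-- The crossings of `right`, as crossings of `mpMove.right`. -/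
def rightIncl : Empty ⊕ right.V → mpMove.right.V :=
  Sum.elim Empty.elim ![⟨0, rfl⟩, ⟨2, rfl⟩, ⟨4, rfl⟩]

theorem rewires : OGraph.Rewires left right mpMove.left mpMove.right leftIncl rightIncl := by
  decide +kernel

/-- The ends of the two versions have different names. Instead of renaming them, the primary move is
performed on `mpMove.left` as a part with no other crossings, and locality does the rest. -/
theorem move_of_mpMove {I O : Type} {Γ Γ' : OGraph I O} (h : mpMove.Move Γ Γ') : Move Γ Γ' :=
  OGraph.LocalMove.trans_part left_proper right_proper mpMove.left_proper mpMove.right_proper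
    (rewires.localMove left_proper right_proper) h

end PrimaryMP

/-! ### The 18 slides and the spanning trees -/

theorem mainTheorem8 :
    ∃ S : Set LocalPSMove, S.ncard = 18 ∧
      (∀ m : MPMove, ∃ A ⊆ S, A.ncard = 15 ∧
        ∀ (m' : MPMove) (I O : Type) [Finite I] [Finite O] (Γ Γ' : OGraph I O),
          m'.Move Γ Γ' → Derivable (fun Δ Δ' => m.Move Δ Δ') A Γ Γ') ∧
      (∃ A ⊆ S, A.ncard = 15 ∧
        ∀ (m' : MPMove) (I O : Type) [Finite I] [Finite O] (Γ Γ' : OGraph I O),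
          m'.Move Γ Γ' → Derivable (fun Δ Δ' => PrimaryMP.Move Δ Δ') A Γ Γ') := by
  have hx : ∀ m : MPMove, ∃ x : LocalPSMove,
      x.base = m ∧ x.kind = m.predKind ∧ x.CompletedBy m.pred := fun m => by
    obtain ⟨l, r, h⟩ := m.decomposes_pred
    exact h.exists_localPSMove
  have hy : ∀ ε : Bool, ∃ y : LocalPSMove,
      y.base = MPMove.bridge ε ∧ y.kind = .II ∧ y.CompletedBy (MPMove.bridgePred ε) := fun ε => by
    obtain ⟨l, r, h⟩ := MPMove.decomposes_bridgePred ε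
    exact h.exists_localPSMove
  choose x hxb hxk hxc using hx
  choose y hyb hyk hyc using hy
  have hxi : x.Injective := fun m n h => by rw [← hxb m, h, hxb]
  have hyi : y.Injective := fun ε δ h =>
    congrArg MPMove.ε ((hyb ε).symm.trans ((congrArg _ h).trans (hyb δ)))
  have hxy : ∀ m ε, x m ≠ y ε := by
    intro m ε h
    have hm : m = MPMove.bridge ε := by rw [← hxb m, h, hyb]
    have hk : m.predKind = .II := by rw [← hxk m, h, hyk]
    rw [hm] at hk
    -- The cycle edge into a bridge move is of type III, the bridge itself of type II.
    cases hk
  let S : Set LocalPSMove := Set.range (Sum.elim x y)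
  have hS : S.ncard = 18 := by
    rw [← Nat.card_coe_set_eq, Nat.card_range_of_injective (hxi.sumElim hyi hxy),
      Nat.card_eq_fintype_card]
    decide +kernel
  have key : ∀ m : MPMove, ∃ A ⊆ S, A.ncard = 15 ∧
      ∀ (m' : MPMove) (I O : Type) (Γ Γ' : OGraph I O),
        m'.Move Γ Γ' → Derivable (fun Δ Δ' => m.Move Δ Δ') A Γ Γ' := by
    intro m
    -- The slide on the tree edge from `m.parent n` to `n`. Its base is `n`, so different `n` give
    -- different slides.
    let e : MPMove → LocalPSMove := fun n => if m.UsesBridge n then y n.ε else x n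
    have heb : ∀ n, (e n).base = n := by
      intro n
      by_cases h : m.UsesBridge n
      · simp only [e, if_pos h, hyb]
        exact h.1.symm
      · simp only [e, if_neg h, hxb]
    have hec : ∀ n, n ≠ m → (e n).CompletedBy (m.parent n) := by
      intro n hn
      by_cases h : m.UsesBridge n
      · simpa only [e, MPMove.parent, if_pos h, if_neg hn] using hyc n.ε
      · simpa only [e, MPMove.parent, if_neg h, if_neg hn] using hxc n
    have hei : e.Injective := fun n n' h => by rw [← heb n, h, heb]
    refine ⟨e '' {n | n ≠ m}, ?_, ?_, ?_⟩
    · rintro _ ⟨n, -, rfl⟩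
      by_cases h : m.UsesBridge n
      · exact ⟨Sum.inr n.ε, by simp [e, h]⟩
      · exact ⟨Sum.inl n, by simp [e, h]⟩
    · have hcard : Nat.card MPMove = 16 := by
        rw [Nat.card_eq_fintype_card]
        decide +kernel
      rw [Set.ncard_image_of_injective _ hei, ← Set.compl_singleton_eq, Set.ncard_compl,
        Set.ncard_singleton, hcard]
    · intro m'
      -- Induction on the number of steps to the root of the tree.
      have main : ∀ (i : ℕ) (n : MPMove), (m.parent)^[i] n = m →
          ∀ (I O : Type) (Γ Γ' : OGraph I O), n.Move Γ Γ' →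
            Derivable (fun Δ Δ' => m.Move Δ Δ') (e '' {n | n ≠ m}) Γ Γ' := by
        intro i
        induction i with
        | zero =>
          intro n hn I O Γ Γ' h
          have hnm : n = m := hn
          exact .rel _ _ (.inl (hnm ▸ h))
        | succ i ih =>
          intro n hn I O Γ Γ' h
          by_cases hnm : n = m
          · exact .rel _ _ (.inl (hnm ▸ h))
          · exact Derivable.of_completedBy (Set.mem_image_of_mem e hnm) (hec n hnm) (ih _ hn) I O Γ Γ'
              ((heb n).symm ▸ h)
      exact main 15 m' (m.iterate_parent m')
  refine ⟨S, hS, fun m => ?_, ?_⟩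
  · obtain ⟨A, hA, hA', h⟩ := key m
    exact ⟨A, hA, hA', fun m' I O _ _ => h m' I O⟩
  · obtain ⟨A, hA, hA', h⟩ := key PrimaryMP.mpMove
    exact ⟨A, hA, hA', fun m' I O _ _ Γ Γ' hm =>
      (h m' I O Γ Γ' hm).mono fun _ _ _ _ => PrimaryMP.move_of_mpMove⟩
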